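/- Let $G$ be a finite group, let $C\trianglelefteq G$ be a normal subgroup, and let $p$ be a prime number or $0$. For $g\in G$ and $H\le G$ put $H^g=g^{-1}Hg$. Let $\underline{A}_G$ be the Burnside Tambara functor of $G$: its value at $G/H$ is the Burnside ring $A(H)$, and for $K\le H\le G$ and $g\in G$ its structure maps are the restriction $\mathrm{res}^H_K\colon A(H)\to A(K)$, the transfer $\mathrm{tr}_K^H\colon A(K)\to A(H)$, $X\mapsto H\times_K X$, the norm $N_K^H\colon A(K)\to A(H)$, $X\mapsto \mathrm{Map}_K(H,X)$ (extended from finite $K$-sets to $A(K)$ by the unique polynomial extension), and the conjugation $c_{g,H}\colon A(H)\to A(H^g)$. For $I\le H\le G$ let $\varphi^I_{H,p}\colon A(H)\to\mathbb{Z}/p\mathbb{Z}$ be the ring homomorphism $X\mapsto |X^I| \bmod p$ (with $\mathbb{Z}/0\mathbb{Z}=\mathbb{Z}$), and for every $H\le G$ define $$\mathfrak{p}_{C,p}(G/H)=\bigcap_{\substack{I\le H\\ I^g\le C\text{ for some } g\in G}}\ker\varphi^I_{H,p}.$$ Then $\mathfrak{p}_{C,p}$ is a prime Tambara ideal of $\underline{A}_G$.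 Here a Tambara ideal $\mathcal{I}$ of $\underline{A}_G$ is a family of ideals $\mathcal{I}(G/H)\subseteq A(H)$, $H\le G$, such that for all $K\le H\le G$ and $g\in G$ $$\mathrm{res}^H_K(\mathcal{I}(G/H))\subseteq\mathcal{I}(G/K),\quad \mathrm{tr}_K^H(\mathcal{I}(G/K))\subseteq\mathcal{I}(G/H),\quad N_K^H(\mathcal{I}(G/K))\subseteq\mathcal{I}(G/H)+N_K^H(0),\quad c_{g,H}(\mathcal{I}(G/H))\subseteq\mathcal{I}(G/H^g).$$ A Tambara ideal $\mathcal{P}$ is prime if $\mathcal{P}(G/H)\ne A(H)$ for some $H\le G$ and, for all Tambara ideals $\mathcal{I},\mathcal{J}$ of $\underline{A}_G$, $\mathcal{I}\mathcal{J}\subseteq\mathcal{P}$ implies $\mathcal{I}\subseteq\mathcal{P}$ or $\mathcal{J}\subseteq\mathcal{P}$ (inclusions are meant at every $G/H$). The product $\mathcal{I}\mathcal{J}(G/H)$ is the set of all elements $f_+(ab)$ with $f\colon S\to G/H$ a map of finite $G$-sets, $a\in\mathcal{I}(S)$ and $b\in\mathcal{J}(S)$. Explicitly, for $S=\coprod_i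 G/K_i$ and $f(xK_i)=xg_iH$ with $K_i^{g_i}\le H$, one has $a=(a_i)$ and $b=(b_i)$ with $a_i\in\mathcal{I}(G/K_i)$, $b_i\in\mathcal{J}(G/K_i)$, and $f_+(ab)=\sum_i \mathrm{tr}_{K_i^{g_i}}^{H}\bigl(c_{g_i,K_i}(a_ib_i)\bigr)$. -/

import Mathlib

/-- The Grothendieck ring of a commutative semiring: the Grothendieck group of its additive monoid,
with the multiplication that extends that of the semiring. -/
def GrothendieckRing (S : Type*) [CommSemiring S] : Type _ := Algebra.GrothendieckAddGroup S

namespace GrothendieckRing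

variable {S : Type*} [CommSemiring S]

noncomputable instance : AddCommGroup (GrothendieckRing S) :=
  inferInstanceAs (AddCommGroup (Algebra.GrothendieckAddGroup S))

/-- The additive map from the semiring to its Grothendieck ring. -/
noncomputable def ofAdd : S →+ GrothendieckRing S := Algebra.GrothendieckAddGroup.of

/-- Additive maps out of the Grothendieck ring. -/
noncomputable def liftAdd {A : Type*} [AddCommGroup A] (f : S →+ A) : GrothendieckRing S →+ A :=
  Algebra.GrothendieckAddGroup.lift f

theorem liftAdd_of {A : Type*} [AddCommGroup A] (f : S →+ A) (x : S) :
    liftAdd f (ofAdd x) = f x :=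
  DFunLike.congr_fun (Algebra.GrothendieckAddGroup.lift.symm_apply_apply f) x

theorem exists_rep (a : GrothendieckRing S) : ∃ x y : S, a = ofAdd x - ofAdd y := by
  obtain ⟨⟨x, y⟩, h⟩ := (AddLocalization.addMonoidOf (⊤ : AddSubmonoid S)).surj a
  exact ⟨x, y, eq_sub_of_add_eq h⟩

theorem ofAdd_eq_iff {x y : S} : ofAdd x = ofAdd y ↔ ∃ c, x + c = y + c := by
  refine ((AddLocalization.addMonoidOf (⊤ : AddSubmonoid S)).eq_iff_exists).trans ?_
  simp [add_comm]

/-- The biadditive extension of the multiplication of the semiring. -/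
noncomputable def mulHom : GrothendieckRing S →+ GrothendieckRing S →+ GrothendieckRing S :=
  liftAdd
    { toFun := fun x => liftAdd (ofAdd.comp (AddMonoidHom.mulLeft x))
      map_zero' := by
        ext a
        obtain ⟨y, z, rfl⟩ := exists_rep a
        simp [liftAdd_of]
      map_add' := fun x x' => by
        ext a
        obtain ⟨y, z, rfl⟩ := exists_rep a
        simp [liftAdd_of, add_mul]
        abel }

noncomputable instance : Mul (GrothendieckRing S) := ⟨fun a b => mulHom a b⟩

noncomputable instance : One (GrothendieckRing S) := ⟨ofAdd 1⟩

theorem mul_def (a b : GrothendieckRing S) : a * b = mulHom a b := rfl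

theorem one_def : (1 : GrothendieckRing S) = ofAdd 1 := rfl

theorem mulHom_of (x y : S) : mulHom (ofAdd x) (ofAdd y) = ofAdd (x * y) := by
  simp [mulHom, liftAdd_of]

noncomputable instance : CommRing (GrothendieckRing S) where
  __ := (inferInstance : AddCommGroup (GrothendieckRing S))
  left_distrib a b c := by simp [mul_def]
  right_distrib a b c := by simp [mul_def]
  zero_mul a := by simp [mul_def]
  mul_zero a := by simp [mul_def]
  mul_assoc a b c := by
    obtain ⟨x, y, rfl⟩ := exists_rep a
    obtain ⟨z, w, rfl⟩ := exists_rep b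
    obtain ⟨u, v, rfl⟩ := exists_rep c
    simp only [mul_def, map_sub, AddMonoidHom.sub_apply, mulHom_of, mul_assoc]
  one_mul a := by
    obtain ⟨x, y, rfl⟩ := exists_rep a
    simp only [mul_def, one_def, map_sub, mulHom_of, one_mul]
  mul_one a := by
    obtain ⟨x, y, rfl⟩ := exists_rep a
    simp only [mul_def, one_def, map_sub, AddMonoidHom.sub_apply, mulHom_of, mul_one]
  mul_comm a b := by
    obtain ⟨x, y, rfl⟩ := exists_rep a
    obtain ⟨z, w, rfl⟩ := exists_rep b
    simp only [mul_def, map_sub, AddMonoidHom.sub_apply, mulHom_of, mul_comm]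
    abel

/-- The canonical semiring homomorphism to the Grothendieck ring. -/
noncomputable def of : S →+* GrothendieckRing S where
  __ := ofAdd
  map_one' := rfl
  map_mul' x y := (mulHom_of x y).symm

/-- Ring homomorphisms out of the Grothendieck ring. -/
noncomputable def lift {R : Type*} [CommRing R] (f : S →+* R) : GrothendieckRing S →+* R where
  __ := liftAdd f.toAddMonoidHom
  map_one' := (liftAdd_of _ _).trans f.map_one
  map_mul' a b := by
    obtain ⟨x, y, rfl⟩ := exists_rep a
    obtain ⟨z, w, rfl⟩ := exists_rep b
    simp [mul_def, mulHom_of, liftAdd_of]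
    ring

theorem lift_of {R : Type*} [CommRing R] (f : S →+* R) (x : S) : lift f (of x) = f x :=
  liftAdd_of _ _

end GrothendieckRing

/-! ### Polynomial maps from a commutative monoid to an abelian group -/

/-- `f` is polynomial of degree less than `n`: all `n`-fold differences of `f` vanish. -/
def PolyDegLT {M A : Type*} [AddCommMonoid M] [AddCommGroup A] : ℕ → (M → A) → Prop
  | 0, f => f = 0
  | n + 1, f => ∀ y, PolyDegLT n (fwdDiff y f)

/-- Newton's forward difference formula for the value at `t = -1` of `t ↦ f (x + t • y)`, where
`f` is polynomial of degree at most `n`. -/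
def newtonSub {M A : Type*} [AddCommMonoid M] [AddCommGroup A] (n : ℕ) (f : M → A) (x y : M) : A :=
  ∑ k ∈ Finset.range (n + 1), (-1 : ℤ) ^ k • (fwdDiff y)^[k] f x

namespace PolyDegLT

variable {M A : Type*} [AddCommMonoid M] [AddCommGroup A]

theorem zero (n : ℕ) : PolyDegLT n (0 : M → A) := by
  induction n with
  | zero => rfl
  | succ n ih =>
    intro y
    have : fwdDiff y (0 : M → A) = 0 := by ext; simp [fwdDiff]
    rwa [this]

theorem iter {n : ℕ} {f : M → A} (hf : PolyDegLT n f) (y : M) : (fwdDiff y)^[n] f = 0 := by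
  induction n generalizing f with
  | zero => exact hf
  | succ n ih => exact ih (hf y)

theorem shift {n : ℕ} {f : M → A} (hf : PolyDegLT n f) (z : M) :
    PolyDegLT n (fun x => f (x + z)) := by
  induction n generalizing f with
  | zero => have h : f = 0 := hf
            subst h; rfl
  | succ n ih =>
    intro y
    have : fwdDiff y (fun x => f (x + z)) = fun x => fwdDiff y f (x + z) := by
      ext x; simp [fwdDiff, add_right_comm]
    rw [this]
    exact ih (hf y)

theorem add {n : ℕ} {f g : M → A} (hf : PolyDegLT n f) (hg : PolyDegLT n g) :
    PolyDegLT n (f + g) := by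
  induction n generalizing f g with
  | zero => have h : f = 0 := hf
            have h' : g = 0 := hg
            subst h h'; exact add_zero _
  | succ n ih => intro y; rw [fwdDiff_add]; exact ih (hf y) (hg y)

theorem smul {n : ℕ} {f : M → A} (c : ℤ) (hf : PolyDegLT n f) : PolyDegLT n (c • f) := by
  induction n generalizing f with
  | zero => have h : f = 0 := hf
            subst h; exact smul_zero _
  | succ n ih => intro y; rw [fwdDiff_const_smul]; exact ih (hf y)

theorem diff {n : ℕ} {f : M → A} (hf : PolyDegLT n f) (y : M) : PolyDegLT n (fwdDiff y f) := by
  have : fwdDiff y f = (fun x => f (x + y)) + (-1 : ℤ) • f := by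
    ext x; simp [fwdDiff, sub_eq_add_neg]
  rw [this]
  exact (hf.shift y).add (hf.smul _)

theorem newton {n m : ℕ} {f : M → A} (hf : PolyDegLT n f) (y : M) :
    PolyDegLT n (fun x => newtonSub m f x y) := by
  have hk (k : ℕ) : PolyDegLT n ((fwdDiff y)^[k] f) := by
    induction k with
    | zero => exact hf
    | succ k ih => rw [Function.iterate_succ_apply']; exact ih.diff y
  induction m with
  | zero => simpa [newtonSub] using hf
  | succ m ih =>
    have : (fun x => newtonSub (m + 1) f x y)
        = (fun x => newtonSub m f x y) + (-1 : ℤ) ^ (m + 1) • (fwdDiff y)^[m + 1] f := by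
      ext x
      simp only [newtonSub, Finset.sum_range_succ _ (m + 1)]
      rfl
    rw [this]
    exact ih.add ((hk _).smul _)

/-- Adding `y` undoes the subtraction of `y`. -/
theorem newton_add {n : ℕ} {f : M → A} (hf : PolyDegLT (n + 1) f) (x y : M) :
    newtonSub n f (x + y) y = f x := by
  have key (m : ℕ) : newtonSub m f (x + y) y = f x + (-1 : ℤ) ^ m • (fwdDiff y)^[m + 1] f x := by
    induction m with
    | zero => simp [newtonSub, fwdDiff]
    | succ m ih =>
      have h1 : newtonSub (m + 1) f (x + y) y = newtonSub m f (x + y) y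
          + (-1 : ℤ) ^ (m + 1) • (fwdDiff y)^[m + 1] f (x + y) := by
        simp only [newtonSub, Finset.sum_range_succ _ (m + 1)]
      have h2 : (fwdDiff y)^[m + 1] f (x + y)
          = (fwdDiff y)^[m + 1] f x + (fwdDiff y)^[m + 2] f x := by
        rw [Function.iterate_succ_apply' _ (m + 1)]
        simp [fwdDiff]
      rw [h1, ih, h2, pow_succ]
      simp only [smul_add, mul_neg, mul_one, neg_smul]
      abel
  rw [key, hf.iter y]
  simp

/-- The value of the extension depends only on the formal difference. -/
theorem newton_cancel {n : ℕ} {f : M → A} (hf : PolyDegLT (n + 1) f) (x y z : M) :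
    newtonSub n f (x + z) (y + z) = newtonSub n f x y := by
  have h1 : (fun u => newtonSub n f (u + y + z) (y + z)) = f := by
    ext u
    rw [add_assoc]
    exact hf.newton_add u (y + z)
  have hg : PolyDegLT (n + 1) (fun u => newtonSub n f (u + z) (y + z)) :=
    (hf.newton (m := n) (y + z)).shift z
  have h2 := hg.newton_add x y
  rw [← h2]
  have hshift (g : M → A) (k : ℕ) (u v w : M) :
      (fwdDiff v)^[k] g (u + w) = (fwdDiff v)^[k] (fun t => g (t + w)) u :=
    (fwdDiff_iter_comp_add (h := v) g w k u).symm
  conv_rhs => rw [← h1]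
  simp only [newtonSub]
  refine Finset.sum_congr rfl fun k _ => ?_
  rw [hshift]

end PolyDegLT

universe u

/-- A finite set with an action of `Γ`. -/
structure FinGSet (Γ : Type u) [Group Γ] where
  carrier : Type u
  [finite : Finite carrier]
  [action : MulAction Γ carrier]

namespace FinGSet

attribute [instance] FinGSet.finite FinGSet.action

variable {Γ Δ : Type u} [Group Γ] [Group Δ]

/-- Isomorphism of finite `Γ`-sets. -/
structure Iso (X Y : FinGSet Γ) where
  toEquiv : X.carrier ≃ Y.carrier
  map_smul : ∀ (g : Γ) (x : X.carrier), toEquiv (g • x) = g • toEquiv x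

theorem Iso.symm_smul {X Y : FinGSet Γ} (e : Iso X Y) (g : Γ) (y : Y.carrier) :
    e.toEquiv.symm (g • y) = g • e.toEquiv.symm y := by
  rw [Equiv.symm_apply_eq, e.map_smul, Equiv.apply_symm_apply]

/-- The relation of being isomorphic. -/
instance setoid (Γ : Type u) [Group Γ] : Setoid (FinGSet Γ) where
  r X Y := Nonempty (Iso X Y)
  iseqv :=
    { refl := fun _ => ⟨⟨Equiv.refl _, fun _ _ => rfl⟩⟩
      symm := fun ⟨e⟩ => ⟨⟨e.toEquiv.symm, e.symm_smul⟩⟩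
      trans := fun ⟨e⟩ ⟨f⟩ =>
        ⟨⟨e.toEquiv.trans f.toEquiv, fun g x => by simp [e.map_smul, f.map_smul]⟩⟩ }

/-- The empty `Γ`-set. -/
def empty (Γ : Type u) [Group Γ] : FinGSet Γ where
  carrier := PEmpty
  action := { smul := fun _ x => x, one_smul := fun _ => rfl, mul_smul := fun _ _ _ => rfl }

/-- The one-point `Γ`-set. -/
def point (Γ : Type u) [Group Γ] : FinGSet Γ where
  carrier := PUnit

/-- Disjoint union, with the action on each summand. -/
def sum (X Y : FinGSet Γ) : FinGSet Γ where
  carrier := X.carrier ⊕ Y.carrier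

/-- Cartesian product, with the diagonal action. -/
def prod (X Y : FinGSet Γ) : FinGSet Γ where
  carrier := X.carrier × Y.carrier

/-- The action pulled back along a group homomorphism. -/
def comap (θ : Δ →* Γ) (X : FinGSet Γ) : FinGSet Δ where
  carrier := X.carrier
  action := MulAction.compHom X.carrier θ

/-- For `θ : Δ →* Γ`, the relation on `Γ × X` generated by `(γ θ(δ), x) ∼ (γ, δ x)`. -/
def indSetoid (θ : Δ →* Γ) (X : FinGSet Δ) : Setoid (Γ × X.carrier) where
  r a b := ∃ δ : Δ, a.1 = b.1 * θ δ ∧ b.2 = δ • a.2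
  iseqv :=
    { refl := fun a => ⟨1, by simp⟩
      symm := fun ⟨δ, h₁, h₂⟩ => ⟨δ⁻¹, by simp [h₁], by simp [h₂]⟩
      trans := fun ⟨δ, h₁, h₂⟩ ⟨ε, h₃, h₄⟩ =>
        ⟨ε * δ, by simp [h₁, h₃, mul_assoc], by simp [h₂, h₄, mul_smul]⟩ }

/-- The induced `Γ`-set `Γ ×_Δ X`, with `γ' [γ, x] = [γ' γ, x]`. -/
def ind [Finite Γ] (θ : Δ →* Γ) (X : FinGSet Δ) : FinGSet Γ where
  carrier := Quotient (indSetoid θ X)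
  action :=
    { smul := fun γ => Quotient.map (fun a => (γ * a.1, a.2)) fun a b ⟨δ, h₁, h₂⟩ =>
        ⟨δ, by simp [h₁, mul_assoc], h₂⟩
      one_smul := by rintro ⟨a⟩; exact congrArg (Quotient.mk _) (Prod.ext (one_mul a.1) rfl)
      mul_smul := by
        rintro γ γ' ⟨a⟩
        exact congrArg (Quotient.mk _) (Prod.ext (mul_assoc γ γ' a.1) rfl) }

theorem smul_ind_mk [Finite Γ] (θ : Δ →* Γ) (X : FinGSet Δ) (γ : Γ) (a : Γ × X.carrier) :
    (γ • (show (ind θ X).carrier from Quotient.mk (indSetoid θ X) a) : (ind θ X).carrier)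
      = Quotient.mk (indSetoid θ X) (γ * a.1, a.2) := rfl

/-- The coinduced `Γ`-set `Map_Δ(Γ, X)`, with `(γ' f) γ = f (γ γ')`. -/
def coind [Finite Γ] (θ : Δ →* Γ) (X : FinGSet Δ) : FinGSet Γ where
  carrier := {f : Γ → X.carrier // ∀ δ γ, f (θ δ * γ) = δ • f γ}
  action :=
    { smul := fun γ' f => ⟨fun γ => f.1 (γ * γ'), fun δ γ =>
        (congrArg f.1 (mul_assoc _ _ _)).trans (f.2 δ (γ * γ'))⟩
      one_smul := fun f => Subtype.ext (funext fun γ => congrArg f.1 (mul_one γ))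
      mul_smul := fun a b f => Subtype.ext (funext fun γ => congrArg f.1 (mul_assoc γ a b).symm) }

theorem smul_coind_apply [Finite Γ] (θ : Δ →* Γ) (X : FinGSet Δ) (γ' γ : Γ)
    (f : (coind θ X).carrier) : (γ' • f).1 γ = f.1 (γ * γ') := rfl

theorem sum_congr {X X' Y Y' : FinGSet Γ} (h : X ≈ X') (h' : Y ≈ Y') :
    X.sum Y ≈ X'.sum Y' := by
  obtain ⟨e⟩ := h
  obtain ⟨f⟩ := h'
  refine ⟨⟨Equiv.sumCongr e.toEquiv f.toEquiv, ?_⟩⟩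
  rintro g (x | y)
  · exact congrArg Sum.inl (e.map_smul g x)
  · exact congrArg Sum.inr (f.map_smul g y)

theorem prod_congr {X X' Y Y' : FinGSet Γ} (h : X ≈ X') (h' : Y ≈ Y') :
    X.prod Y ≈ X'.prod Y' := by
  obtain ⟨e⟩ := h
  obtain ⟨f⟩ := h'
  refine ⟨⟨Equiv.prodCongr e.toEquiv f.toEquiv, ?_⟩⟩
  rintro g ⟨x, y⟩
  exact Prod.ext (e.map_smul g x) (f.map_smul g y)

theorem comap_congr (θ : Δ →* Γ) {X Y : FinGSet Γ} (h : X ≈ Y) : comap θ X ≈ comap θ Y := by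
  obtain ⟨e⟩ := h
  exact ⟨⟨e.toEquiv, fun δ x => e.map_smul (θ δ) x⟩⟩

theorem ind_congr [Finite Γ] (θ : Δ →* Γ) {X Y : FinGSet Δ} (h : X ≈ Y) :
    ind θ X ≈ ind θ Y := by
  obtain ⟨e⟩ := h
  refine ⟨⟨Quotient.congr (Equiv.prodCongr (Equiv.refl Γ) e.toEquiv) ?_, ?_⟩⟩
  · rintro ⟨γ, x⟩ ⟨γ', x'⟩
    refine exists_congr fun δ => and_congr Iff.rfl ?_
    simp [← e.map_smul]
  · rintro γ ⟨a⟩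
    rfl

theorem ind_sum [Finite Γ] (θ : Δ →* Γ) (X Y : FinGSet Δ) :
    ind θ (X.sum Y) ≈ (ind θ X).sum (ind θ Y) := by
  let F : (ind θ (X.sum Y)).carrier → ((ind θ X).sum (ind θ Y)).carrier :=
    Quotient.lift
      (fun a => match a with
        | (γ, Sum.inl x) => Sum.inl (Quotient.mk (indSetoid θ X) (γ, x))
        | (γ, Sum.inr y) => Sum.inr (Quotient.mk (indSetoid θ Y) (γ, y)))
      (by
        rintro ⟨γ, x | y⟩ ⟨γ', x' | y'⟩ ⟨δ, h₁, h₂⟩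
        · exact congrArg Sum.inl (Quotient.sound ⟨δ, h₁, Sum.inl_injective h₂⟩)
        · cases h₂
        · cases h₂
        · exact congrArg Sum.inr (Quotient.sound ⟨δ, h₁, Sum.inr_injective h₂⟩))
  let B : ((ind θ X).sum (ind θ Y)).carrier → (ind θ (X.sum Y)).carrier :=
    Sum.elim
      (Quotient.map (fun a => (a.1, Sum.inl a.2))
        fun a b ⟨δ, h₁, h₂⟩ => ⟨δ, h₁, congrArg Sum.inl h₂⟩)
      (Quotient.map (fun a => (a.1, Sum.inr a.2))
        fun a b ⟨δ, h₁, h₂⟩ => ⟨δ, h₁, congrArg Sum.inr h₂⟩)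
  refine ⟨⟨⟨F, B, ?_, ?_⟩, ?_⟩⟩
  · rintro ⟨γ, x | y⟩ <;> rfl
  · rintro (⟨γ, x⟩ | ⟨γ, y⟩) <;> rfl
  · rintro γ ⟨γ', x | y⟩ <;> rfl

end FinGSet

/-- The commutative semiring of isomorphism classes of finite `Γ`-sets. -/
def BurnsideSemiring (Γ : Type u) [Group Γ] := Quotient (FinGSet.setoid Γ)

namespace BurnsideSemiring

open FinGSet

variable {Γ Δ : Type u} [Group Γ] [Group Δ]

/-- The isomorphism class of a finite `Γ`-set. -/
def mk (X : FinGSet Γ) : BurnsideSemiring Γ := Quotient.mk _ X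

theorem sound {X Y : FinGSet Γ} (h : X ≈ Y) : mk X = mk Y := Quotient.sound h

theorem ind_mk {P : BurnsideSemiring Γ → Prop} (h : ∀ X, P (mk X)) (a) : P a := Quotient.ind h a

instance : Add (BurnsideSemiring Γ) :=
  ⟨Quotient.map₂ FinGSet.sum fun _ _ h _ _ h' => sum_congr h h'⟩
instance : Mul (BurnsideSemiring Γ) :=
  ⟨Quotient.map₂ FinGSet.prod fun _ _ h _ _ h' => prod_congr h h'⟩
instance : Zero (BurnsideSemiring Γ) := ⟨mk (empty Γ)⟩
instance : One (BurnsideSemiring Γ) := ⟨mk (point Γ)⟩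

theorem mk_add (X Y : FinGSet Γ) : mk X + mk Y = mk (X.sum Y) := rfl
theorem mk_mul (X Y : FinGSet Γ) : mk X * mk Y = mk (X.prod Y) := rfl
theorem mk_zero : (0 : BurnsideSemiring Γ) = mk (empty Γ) := rfl
theorem mk_one : (1 : BurnsideSemiring Γ) = mk (point Γ) := rfl

protected theorem add_comm (a b : BurnsideSemiring Γ) : a + b = b + a := by
  induction a using ind_mk with | h X =>
  induction b using ind_mk with | h Y =>
  exact sound ⟨⟨Equiv.sumComm _ _, by rintro g (x | y) <;> rfl⟩⟩

protected theorem mul_comm (a b : BurnsideSemiring Γ) : a * b = b * a := by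
  induction a using ind_mk with | h X =>
  induction b using ind_mk with | h Y =>
  exact sound ⟨⟨Equiv.prodComm _ _, fun _ _ => rfl⟩⟩

protected theorem zero_add (a : BurnsideSemiring Γ) : 0 + a = a := by
  induction a using ind_mk with | h X =>
  exact sound ⟨⟨Equiv.emptySum PEmpty X.carrier, by rintro g (x | y) <;> [cases x; rfl]⟩⟩

protected theorem one_mul (a : BurnsideSemiring Γ) : 1 * a = a := by
  induction a using ind_mk with | h X =>
  exact sound ⟨⟨Equiv.punitProd X.carrier, fun _ _ => rfl⟩⟩

protected theorem zero_mul (a : BurnsideSemiring Γ) : 0 * a = 0 := by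
  induction a using ind_mk with | h X =>
  exact sound ⟨⟨Equiv.pemptyProd X.carrier, fun _ x => x.1.elim⟩⟩

protected theorem add_mul (a b c : BurnsideSemiring Γ) : (a + b) * c = a * c + b * c := by
  induction a using ind_mk with | h X =>
  induction b using ind_mk with | h Y =>
  induction c using ind_mk with | h Z =>
  exact sound ⟨⟨Equiv.sumProdDistrib _ _ _, by rintro g ⟨x | y, z⟩ <;> rfl⟩⟩

instance : CommSemiring (BurnsideSemiring Γ) where
  add_assoc a b c := by
    induction a using ind_mk with | h X =>
    induction b using ind_mk with | h Y =>
    induction c using ind_mk with | h Z =>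
    exact sound ⟨⟨Equiv.sumAssoc _ _ _, by rintro g ((x | y) | z) <;> rfl⟩⟩
  zero_add := BurnsideSemiring.zero_add
  add_zero a := by rw [BurnsideSemiring.add_comm, BurnsideSemiring.zero_add]
  add_comm := BurnsideSemiring.add_comm
  nsmul := nsmulRec
  left_distrib a b c := by
    rw [BurnsideSemiring.mul_comm, BurnsideSemiring.add_mul, BurnsideSemiring.mul_comm b,
      BurnsideSemiring.mul_comm c]
  right_distrib := BurnsideSemiring.add_mul
  zero_mul := BurnsideSemiring.zero_mul
  mul_zero a := by rw [BurnsideSemiring.mul_comm, BurnsideSemiring.zero_mul]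
  mul_assoc a b c := by
    induction a using ind_mk with | h X =>
    induction b using ind_mk with | h Y =>
    induction c using ind_mk with | h Z =>
    exact sound ⟨⟨Equiv.prodAssoc _ _ _, fun _ _ => rfl⟩⟩
  one_mul := BurnsideSemiring.one_mul
  mul_one a := by rw [BurnsideSemiring.mul_comm, BurnsideSemiring.one_mul]
  mul_comm := BurnsideSemiring.mul_comm

/-- Pullback of actions along a group homomorphism. -/
def comap (θ : Δ →* Γ) : BurnsideSemiring Γ →+* BurnsideSemiring Δ where
  toFun := Quotient.map (FinGSet.comap θ) fun _ _ h => comap_congr θ h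
  map_zero' := sound ⟨⟨Equiv.refl _, fun _ x => x.elim⟩⟩
  map_one' := sound ⟨⟨Equiv.refl _, fun _ _ => rfl⟩⟩
  map_add' a b := by
    induction a using ind_mk with | h X =>
    induction b using ind_mk with | h Y =>
    exact sound ⟨⟨Equiv.refl _, by rintro g (x | y) <;> rfl⟩⟩
  map_mul' a b := by
    induction a using ind_mk with | h X =>
    induction b using ind_mk with | h Y =>
    exact sound ⟨⟨Equiv.refl _, fun _ _ => rfl⟩⟩

/-- Induction of finite sets with an action. -/
def ind [Finite Γ] (θ : Δ →* Γ) : BurnsideSemiring Δ →+ BurnsideSemiring Γ where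
  toFun := Quotient.map (FinGSet.ind θ) fun _ _ h => ind_congr θ h
  map_zero' := sound ⟨⟨⟨fun q => Quotient.lift (fun a => a.2.elim) (fun a => a.2.elim) q,
    fun x => x.elim, by rintro ⟨γ, ⟨⟩⟩, by rintro ⟨⟩⟩, by rintro g ⟨γ, ⟨⟩⟩⟩⟩
  map_add' a b := by
    induction a using ind_mk with | h X =>
    induction b using ind_mk with | h Y =>
    exact sound (ind_sum θ X Y)

/-- The number of points fixed by the subgroup `I`. -/
noncomputable def mark (I : Subgroup Γ) : BurnsideSemiring Γ →+* ℤ where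
  toFun := Quotient.lift (fun X => (Nat.card {x : X.carrier // ∀ g ∈ I, g • x = x} : ℤ)) (by
    rintro X Y ⟨e⟩
    exact congrArg _ (Nat.card_congr (e.toEquiv.subtypeEquiv fun x => by
      simp [← e.map_smul])))
  map_zero' := by
    refine Nat.cast_eq_zero.2 ?_
    have : IsEmpty {x : (empty Γ).carrier // ∀ g ∈ I, g • x = x} := ⟨fun x => x.1.elim⟩
    exact Nat.card_of_isEmpty
  map_one' := by
    refine Nat.cast_eq_one.2 ?_
    rw [Nat.card_eq_one_iff_unique]
    exact ⟨⟨fun _ _ => Subtype.ext (Subsingleton.elim (α := PUnit) _ _)⟩,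
      ⟨⟨PUnit.unit, fun _ _ => rfl⟩⟩⟩
  map_add' a b := by
    induction a using ind_mk with | h X =>
    induction b using ind_mk with | h Y =>
    refine Eq.trans ?_ (Nat.cast_add _ _)
    rw [← Nat.card_sum]
    refine congrArg _ (Nat.card_congr ((Equiv.subtypeSum).trans (Equiv.sumCongr ?_ ?_)))
    · exact Equiv.subtypeEquivRight fun x =>
        forall₂_congr fun g _ => Sum.inl_injective.eq_iff (a := g • x)
    · exact Equiv.subtypeEquivRight fun x =>
        forall₂_congr fun g _ => Sum.inr_injective.eq_iff (a := g • x)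
  map_mul' a b := by
    induction a using ind_mk with | h X =>
    induction b using ind_mk with | h Y =>
    refine Eq.trans ?_ (Nat.cast_mul _ _)
    rw [← Nat.card_prod]
    refine congrArg _ (Nat.card_congr (Equiv.trans (Equiv.subtypeEquivRight fun x => ?_)
      Equiv.subtypeProdEquivProd))
    constructor
    · exact fun h => ⟨fun g hg => congrArg Prod.fst (h g hg), fun g hg => congrArg Prod.snd (h g hg)⟩
    · exact fun h g hg => Prod.ext (h.1 g hg) (h.2 g hg)

end BurnsideSemiring

/-! ### Coinduction is a polynomial map -/

namespace FinGSet

variable {Γ Δ : Type u} [Group Γ] [Group Δ] [Finite Γ]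

/-- The `Γ`-set of the maps in `Map_Δ(Γ, W)` that attain every colour `i : ι`, where the points of
`W` carry at most one colour each. -/
def coindHit (θ : Δ →* Γ) (W : FinGSet Δ) {ι : Type} (c : W.carrier → Option ι) : FinGSet Γ where
  carrier := {f : (coind θ W).carrier // ∀ i, ∃ γ, c (f.1 γ) = some i}
  action :=
    { smul := fun γ' f => ⟨γ' • f.1, fun i => by
        obtain ⟨γ, h⟩ := f.2 i
        exact ⟨γ * γ'⁻¹, by rw [smul_coind_apply, inv_mul_cancel_right, h]⟩⟩
      one_smul := fun f => Subtype.ext (one_smul Γ f.1)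
      mul_smul := fun a b f => Subtype.ext (mul_smul a b f.1) }

theorem coindHit_congr (θ : Δ →* Γ) {W W' : FinGSet Δ} {ι : Type} (c : W.carrier → Option ι)
    (c' : W'.carrier → Option ι) (e : Iso W W') (h : ∀ w, c' (e.toEquiv w) = c w) :
    coindHit θ W c ≈ coindHit θ W' c' := by
  refine ⟨⟨⟨fun f => ⟨⟨fun γ => e.toEquiv (f.1.1 γ), fun δ γ => ?_⟩, fun i => ?_⟩,
    fun f => ⟨⟨fun γ => e.toEquiv.symm (f.1.1 γ), fun δ γ => ?_⟩, fun i => ?_⟩, fun f => ?_,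
    fun f => ?_⟩, fun γ f => rfl⟩⟩
  · exact (congrArg e.toEquiv (f.1.2 δ γ)).trans (e.map_smul δ _)
  · obtain ⟨γ, hγ⟩ := f.2 i
    exact ⟨γ, (h _).trans hγ⟩
  · exact (congrArg e.toEquiv.symm (f.1.2 δ γ)).trans (e.symm_smul δ _)
  · obtain ⟨γ, hγ⟩ := f.2 i
    exact ⟨γ, by rw [← h, Equiv.apply_symm_apply, hγ]⟩
  · exact Subtype.ext (Subtype.ext (funext fun γ => e.toEquiv.symm_apply_apply _))
  · exact Subtype.ext (Subtype.ext (funext fun γ => e.toEquiv.apply_symm_apply _))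

/-- A map to `W ⊔ Y` either stays in `W` or attains the additional colour given to `Y`. -/
theorem coindHit_split (θ : Δ →* Γ) (W Y : FinGSet Δ) {ι : Type} (c : W.carrier → Option ι) :
    (coindHit θ W c).sum (coindHit θ (W.sum Y)
        (Sum.elim (fun w => (c w).map some) fun _ => some none))
      ≈ coindHit θ (W.sum Y) (Sum.elim c fun _ => none) := by
  have hhit (f : (coind θ (W.sum Y)).carrier) (i : ι) (γ : Γ) :
      Sum.elim (fun w => (c w).map some) (fun _ => some none) (f.1 γ) = some (some i)
        ↔ Sum.elim c (fun _ => none) (f.1 γ) = some i := by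
    rcases f.1 γ with w | y <;> simp
  let B : ((coindHit θ W c).sum (coindHit θ (W.sum Y)
        (Sum.elim (fun w => (c w).map some) fun _ => some none))).carrier →
      (coindHit θ (W.sum Y) (Sum.elim c fun _ => none)).carrier :=
    Sum.elim
      (fun f => ⟨⟨fun γ => Sum.inl (f.1.1 γ), fun δ γ => congrArg Sum.inl (f.1.2 δ γ)⟩, f.2⟩)
      (fun f => ⟨f.1, fun i => (f.2 (some i)).imp fun γ => (hhit f.1 i γ).1⟩)
  have hB : Function.Bijective B := by
    constructor
    · rintro (f | f) (g | g) h
      · refine congrArg Sum.inl (Subtype.ext (Subtype.ext (funext fun γ => ?_)))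
        exact Sum.inl_injective (congrFun (congrArg (fun k => k.1.1) h) γ)
      · obtain ⟨γ, hγ⟩ := g.2 none
        have h1 : Sum.inl (f.1.1 γ) = g.1.1 γ := congrFun (congrArg (fun k => k.1.1) h) γ
        rw [← h1] at hγ
        simp at hγ
      · obtain ⟨γ, hγ⟩ := f.2 none
        have h1 : f.1.1 γ = Sum.inl (g.1.1 γ) := congrFun (congrArg (fun k => k.1.1) h) γ
        rw [h1] at hγ
        simp at hγ
      · exact congrArg Sum.inr (Subtype.ext (congrArg (fun k => k.1) h))
    · intro f
      by_cases hf : ∃ γ y, f.1.1 γ = Sum.inr y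
      · obtain ⟨γ, y, hy⟩ := hf
        refine ⟨Sum.inr ⟨f.1, fun o => ?_⟩, rfl⟩
        cases o with
        | none => exact ⟨γ, by rw [hy]; rfl⟩
        | some i => exact (f.2 i).imp fun γ => (hhit f.1 i γ).2
      · have hl (γ : Γ) : ∃ w, Sum.inl w = f.1.1 γ := by
          rcases h : f.1.1 γ with w | y
          · exact ⟨w, rfl⟩
          · exact absurd ⟨γ, y, h⟩ hf
        choose k hk using hl
        refine ⟨Sum.inl ⟨⟨k, fun δ γ => ?_⟩, fun i => ?_⟩, ?_⟩
        · apply Sum.inl_injective (β := Y.carrier)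
          rw [hk, f.1.2, ← hk]
          rfl
        · obtain ⟨γ, hγ⟩ := f.2 i
          refine ⟨γ, ?_⟩
          rw [← hk] at hγ
          exact hγ
        · exact Subtype.ext (Subtype.ext (funext hk))
  refine ⟨⟨Equiv.ofBijective B hB, ?_⟩⟩
  rintro γ (f | f) <;> rfl

/-- An equivariant map attains at most as many colours as there are cosets. -/
theorem coindHit_isEmpty (θ : Δ →* Γ) (W : FinGSet Δ) {ι : Type} [Finite ι]
    (c : W.carrier → Option ι) (hc : ∀ (δ : Δ) w, c (δ • w) = c w)
    (h : θ.range.index < Nat.card ι) : IsEmpty (coindHit θ W c).carrier := by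
  refine ⟨fun f => ?_⟩
  choose γ hγ using f.2
  have hinj : Function.Injective
      (fun i => (Quotient.mk (QuotientGroup.rightRel θ.range) (γ i))) := by
    intro i j hij
    obtain ⟨δ, hδ⟩ := QuotientGroup.rightRel_apply.1 (Quotient.exact hij)
    have h1 : γ j = θ δ * γ i := by rw [hδ]; group
    have h2 := hγ j
    rw [h1, f.1.2, hc, hγ i] at h2
    exact Option.some_injective _ h2
  have h3 := Nat.card_le_card_of_injective _ hinj
  rw [Nat.card_congr (QuotientGroup.quotientRightRelEquivQuotientLeftRel θ.range)] at h3
  exact absurd h3 (not_le.2 h)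

end FinGSet

namespace BurnsideSemiring

open FinGSet

variable {Γ Δ : Type u} [Group Γ] [Group Δ] [Finite Γ]

/-- The class of the `Γ`-set of maps to `X ⊔ Z` that attain every colour of `Z`. -/
def coindHit (θ : Δ →* Γ) (Z : FinGSet Δ) {ι : Type} (c : Z.carrier → ι) :
    BurnsideSemiring Δ → BurnsideSemiring Γ :=
  Quotient.map (fun X => FinGSet.coindHit θ (X.sum Z) (Sum.elim (fun _ => none) fun z => some (c z)))
    (by
      rintro X Y ⟨e⟩
      refine coindHit_congr θ _ _ ⟨Equiv.sumCongr e.toEquiv (Equiv.refl _), ?_⟩ ?_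
      · rintro g (x | y)
        · exact congrArg Sum.inl (e.map_smul g x)
        · rfl
      · rintro (x | y) <;> rfl)

/-- The map `X ↦ Map_Δ(Γ, X)` on isomorphism classes. -/
def coind (θ : Δ →* Γ) : BurnsideSemiring Δ → BurnsideSemiring Γ :=
  Quotient.map (FinGSet.coind θ) (by
    rintro X Y ⟨e⟩
    refine ⟨⟨⟨fun f => ⟨fun γ => e.toEquiv (f.1 γ), fun δ γ => ?_⟩,
      fun f => ⟨fun γ => e.toEquiv.symm (f.1 γ), fun δ γ => ?_⟩, fun f => ?_, fun f => ?_⟩,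
      fun γ f => rfl⟩⟩
    · exact (congrArg e.toEquiv (f.2 δ γ)).trans (e.map_smul δ _)
    · exact (congrArg e.toEquiv.symm (f.2 δ γ)).trans (e.symm_smul δ _)
    · exact Subtype.ext (funext fun γ => e.toEquiv.symm_apply_apply _)
    · exact Subtype.ext (funext fun γ => e.toEquiv.apply_symm_apply _))

theorem coindHit_polyDegLT (θ : Δ →* Γ) (n : ℕ) (Z : FinGSet Δ) {ι : Type} [Finite ι]
    (c : Z.carrier → ι) (hc : ∀ (δ : Δ) z, c (δ • z) = c z)
    (h : θ.range.index < Nat.card ι + n) :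
    PolyDegLT n (fun a => GrothendieckRing.of (coindHit θ Z c a)) := by
  induction n generalizing Z ι with
  | zero =>
    funext a
    induction a using ind_mk with | h X =>
    have hE : IsEmpty (FinGSet.coindHit θ (X.sum Z)
        (Sum.elim (fun _ => none) fun z => some (c z))).carrier := by
      refine coindHit_isEmpty θ _ _ ?_ h
      rintro δ (x | z)
      · rfl
      · exact congrArg some (hc δ z)
    have h0 : coindHit θ Z c (mk X) = 0 :=
      sound ⟨⟨⟨fun x => hE.elim x, fun x => x.elim, fun x => hE.elim x, fun x => x.elim⟩,
        fun _ x => hE.elim x⟩⟩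
    simp [h0]
  | succ n ih =>
    intro b
    induction b using ind_mk with | h Y =>
    have key : fwdDiff (mk Y) (fun a => GrothendieckRing.of (coindHit θ Z c a))
        = fun a => GrothendieckRing.of (coindHit θ (Z.sum Y)
            (Sum.elim (fun z => some (c z)) (fun _ => none) : _ → Option ι) a) := by
      funext a
      induction a using ind_mk with | h X =>
      have h1 : coindHit θ Z c (mk X + mk Y) = coindHit θ Z c (mk X)
          + coindHit θ (Z.sum Y) (Sum.elim (fun z => some (c z)) (fun _ => none)) (mk X) := by
        refine Eq.trans ?_ ((sound (coindHit_split θ (X.sum Z) Y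
          (Sum.elim (fun _ => none) fun z => some (c z)))).symm.trans ?_)
        · refine sound (coindHit_congr θ _ _
            ⟨⟨fun w => match w with
              | Sum.inl (Sum.inl x) => Sum.inl (Sum.inl x)
              | Sum.inl (Sum.inr y) => Sum.inr y
              | Sum.inr z => Sum.inl (Sum.inr z),
              fun w => match w with
              | Sum.inl (Sum.inl x) => Sum.inl (Sum.inl x)
              | Sum.inl (Sum.inr z) => Sum.inr z
              | Sum.inr y => Sum.inl (Sum.inr y), ?_, ?_⟩, ?_⟩ ?_)
          · rintro ((x | y) | z) <;> rfl
          · rintro ((x | y) | z) <;> rfl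
          · rintro g ((x | y) | z) <;> rfl
          · rintro ((x | y) | z) <;> rfl
        · refine (mk_add _ _).symm.trans (congrArg₂ _ rfl ?_)
          refine sound (coindHit_congr θ _ _ ⟨Equiv.sumAssoc _ _ _, ?_⟩ ?_)
          · rintro g ((x | y) | z) <;> rfl
          · rintro ((x | y) | z) <;> rfl
      simp only [fwdDiff, h1, map_add, add_sub_cancel_left]
    rw [key]
    refine ih _ _ ?_ ?_
    · rintro δ (z | y)
      · exact congrArg some (hc δ z)
      · rfl
    · rw [Finite.card_option]
      omega

theorem coind_polyDegLT (θ : Δ →* Γ) :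
    PolyDegLT (θ.range.index + 1) (fun a => GrothendieckRing.of (coind θ a)) := by
  have h := coindHit_polyDegLT θ (θ.range.index + 1) (FinGSet.empty Δ) (ι := Empty)
    (fun z => z.elim) (fun _ z => z.elim) (by omega)
  convert h using 2 with a
  induction a using ind_mk with | h X =>
  refine congrArg _ (sound ?_)
  let e : X.carrier ≃ (X.sum (FinGSet.empty Δ)).carrier := (Equiv.sumEmpty _ PEmpty).symm
  have he (δ : Δ) (x : X.carrier) : e (δ • x) = δ • e x := rfl
  have he' (δ : Δ) (x) : e.symm (δ • x) = δ • e.symm x := by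
    rw [Equiv.symm_apply_eq, he, Equiv.apply_symm_apply]
  refine ⟨⟨⟨fun f => ⟨⟨fun γ => e (f.1 γ), fun δ γ => ?_⟩, fun i => i.elim⟩,
    fun f => ⟨fun γ => e.symm (f.1.1 γ), fun δ γ => ?_⟩, fun f => ?_, fun f => ?_⟩, fun γ f => rfl⟩⟩
  · exact congrArg e (f.2 δ γ)
  · exact (congrArg e.symm (f.1.2 δ γ)).trans (he' δ _)
  · exact Subtype.ext (funext fun γ => e.symm_apply_apply _)
  · exact Subtype.ext (Subtype.ext (funext fun γ => e.apply_symm_apply _))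

end BurnsideSemiring

/-- The Burnside ring `A(Γ)`. -/
abbrev BurnsideRing (Γ : Type u) [Group Γ] := GrothendieckRing (BurnsideSemiring Γ)

namespace BurnsideRing

variable {Γ Δ : Type u} [Group Γ] [Group Δ]

/-- The class of a finite `Γ`-set in the Burnside ring. -/
noncomputable def ofSet (X : FinGSet Γ) : BurnsideRing Γ :=
  GrothendieckRing.of (BurnsideSemiring.mk X)

/-- The ring homomorphism `X ↦ X`, with the action pulled back along `θ`. -/
noncomputable def comap (θ : Δ →* Γ) : BurnsideRing Γ →+* BurnsideRing Δ :=
  GrothendieckRing.lift (GrothendieckRing.of.comp (BurnsideSemiring.comap θ))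

/-- The additive homomorphism `X ↦ Γ ×_Δ X`. -/
noncomputable def ind [Finite Γ] (θ : Δ →* Γ) : BurnsideRing Δ →+ BurnsideRing Γ :=
  GrothendieckRing.liftAdd (GrothendieckRing.ofAdd.comp (BurnsideSemiring.ind θ))

/-- The map `X ↦ Map_Δ(Γ, X)`, extended from finite `Δ`-sets to all of `A(Δ)`: it is the extension
that is again polynomial of degree at most the index of `Δ` in `Γ`. Its value at `X - Y` is the
value at `t = -1` of the polynomial map `t ↦ Map_Δ(Γ, X + t Y)`. By `coind_of_sub_of` it does not
depend on the way in which the element is written as a difference, and by `coind_ofSet` it extends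
the given map. -/
noncomputable def coind [Finite Γ] (θ : Δ →* Γ) (a : BurnsideRing Δ) : BurnsideRing Γ :=
  newtonSub θ.range.index (fun x => GrothendieckRing.of (BurnsideSemiring.coind θ x))
    (GrothendieckRing.exists_rep a).choose (GrothendieckRing.exists_rep a).choose_spec.choose

/-- The mark homomorphism `φ_Γ^I : X ↦ |X^I|`. -/
noncomputable def mark (I : Subgroup Γ) : BurnsideRing Γ →+* ℤ :=
  GrothendieckRing.lift (BurnsideSemiring.mark I)

/-- The mark homomorphism `φ_{Γ,p}^I` modulo `p`. -/
noncomputable def markMod (p : ℕ) (I : Subgroup Γ) : BurnsideRing Γ →+* ZMod p :=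
  (Int.castRingHom (ZMod p)).comp (mark I)

theorem coind_of_sub_of [Finite Γ] (θ : Δ →* Γ) (x y : BurnsideSemiring Δ) :
    coind θ (GrothendieckRing.of x - GrothendieckRing.of y)
      = newtonSub θ.range.index (fun z => GrothendieckRing.of (BurnsideSemiring.coind θ z)) x y := by
  set a : BurnsideRing Δ := GrothendieckRing.of x - GrothendieckRing.of y with ha
  have hpoly := BurnsideSemiring.coind_polyDegLT (Γ := Γ) θ
  unfold coind
  set x' := (GrothendieckRing.exists_rep a).choose
  set y' := (GrothendieckRing.exists_rep a).choose_spec.choose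
  have h : a = GrothendieckRing.ofAdd x' - GrothendieckRing.ofAdd y' :=
    (GrothendieckRing.exists_rep a).choose_spec.choose_spec
  have h1 : GrothendieckRing.ofAdd (x + y') = GrothendieckRing.ofAdd (x' + y) := by
    have h2 : GrothendieckRing.ofAdd x - GrothendieckRing.ofAdd y
        = GrothendieckRing.ofAdd x' - GrothendieckRing.ofAdd y' := ha.symm.trans h
    rw [map_add, map_add]
    exact sub_eq_sub_iff_add_eq_add.1 h2
  obtain ⟨c, hc⟩ := GrothendieckRing.ofAdd_eq_iff.1 h1
  rw [← hpoly.newton_cancel x y (y' + c), ← hpoly.newton_cancel x' y' (y + c),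
    ← add_assoc x y' c, ← add_assoc x' y c, hc]
  congr 1
  abel

theorem coind_ofSet [Finite Γ] (θ : Δ →* Γ) (X : FinGSet Δ) :
    coind θ (ofSet X) = ofSet (FinGSet.coind θ X) := by
  have h := coind_of_sub_of θ (BurnsideSemiring.mk X) 0
  rw [map_zero, sub_zero] at h
  have h0 (k : ℕ) (f : BurnsideSemiring Δ → BurnsideRing Γ) :
      (fwdDiff (0 : BurnsideSemiring Δ))^[k + 1] f = 0 := by
    have : fwdDiff (0 : BurnsideSemiring Δ) f = 0 := by ext; simp [fwdDiff]
    rw [Function.iterate_succ_apply, this]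
    exact (PolyDegLT.zero k).iter 0
  refine h.trans ?_
  rw [newtonSub, Finset.sum_range_succ', Finset.sum_eq_zero]
  · simp only [pow_zero, one_smul, zero_add, Function.iterate_zero, id]
    rfl
  · intro k _
    rw [h0]
    simp

end BurnsideRing

/-! ### The Burnside Tambara functor and its ideals -/

namespace BurnsideTambara

variable {G : Type u} [Group G]

/-- The conjugate `H^g = g⁻¹ H g`. -/
def conjSubgroup (H : Subgroup G) (g : G) : Subgroup G := H.comap (MulAut.conj g).toMonoidHom

theorem mem_conjSubgroup {H : Subgroup G} {g k : G} :
    k ∈ conjSubgroup H g ↔ g * k * g⁻¹ ∈ H := Iff.rfl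

/-- The value `A(H)` of the Burnside Tambara functor of `G` at `G/H`. -/
abbrev A (H : Subgroup G) := BurnsideRing H

/-- Restriction `A(H) → A(K)`. -/
noncomputable def res {K H : Subgroup G} (h : K ≤ H) : A H →+* A K :=
  BurnsideRing.comap (Subgroup.inclusion h)

/-- Transfer `A(K) → A(H)`, `X ↦ H ×_K X`. -/
noncomputable def tr [Finite G] {K H : Subgroup G} (h : K ≤ H) : A K →+ A H :=
  BurnsideRing.ind (Subgroup.inclusion h)

/-- Norm `A(K) → A(H)`, `X ↦ Map_K(H, X)` on finite `K`-sets. -/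
noncomputable def norm [Finite G] {K H : Subgroup G} (h : K ≤ H) : A K → A H :=
  BurnsideRing.coind (Subgroup.inclusion h)

/-- Conjugation `A(H) → A(H^g)`, `X ↦ X^g`, where `k ∈ H^g` acts on `X^g = X` as `g k g⁻¹ ∈ H`. -/
noncomputable def conj (H : Subgroup G) (g : G) : A H →+* A (conjSubgroup H g) :=
  BurnsideRing.comap ((MulAut.conj g).toMonoidHom.subgroupComap H)

/-- Ideals of the Burnside Tambara functor of `G`: families of ideals `I(G/H) ⊆ A(H)` closed under
restriction, transfer, conjugation and norm, the last up to the norm of `0`. -/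
structure IsTambaraIdeal [Finite G] (I : ∀ H : Subgroup G, Ideal (A H)) : Prop where
  res_mem : ∀ {K H : Subgroup G} (h : K ≤ H), ∀ a ∈ I H, res h a ∈ I K
  tr_mem : ∀ {K H : Subgroup G} (h : K ≤ H), ∀ a ∈ I K, tr h a ∈ I H
  norm_mem : ∀ {K H : Subgroup G} (h : K ≤ H), ∀ a ∈ I K, ∃ b ∈ I H, norm h a = b + norm h 0
  conj_mem : ∀ (H : Subgroup G) (g : G), ∀ a ∈ I H, conj H g a ∈ I (conjSubgroup H g)

/-- The map `f_+ : A(G/K) → A(G/H)` for the `G`-map `f : G/K → G/H`, `x K ↦ x g H`, which exists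
exactly if `K^g ≤ H`. Every `G`-map `G/K → G/H` has this form. -/
noncomputable def trMap [Finite G] {K H : Subgroup G} (g : G) (h : conjSubgroup K g ≤ H) :
    A K →+ A H :=
  (tr h).comp (conj K g).toAddMonoidHom

/-- The product `I J` of Tambara ideals at `G/H`: the elements `f_+ (a b)` for a finite `G`-set `S`,
a `G`-map `f : S → G/H`, `a ∈ I(S)` and `b ∈ J(S)`. Here `S = ∐_{i < n} G/K_i`, so that `f` is given
by `G`-maps `f_i : G/K_i → G/H`, `I(S) = ∏ I(G/K_i)`, and `f_+ (a b) = ∑ (f_i)_+ (a_i b_i)`. -/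
def mulSet [Finite G] (I J : ∀ H : Subgroup G, Ideal (A H)) (H : Subgroup G) : Set (A H) :=
  {c | ∃ (n : ℕ) (K : Fin n → Subgroup G) (g : Fin n → G) (h : ∀ i, conjSubgroup (K i) (g i) ≤ H)
    (a b : ∀ i, A (K i)), (∀ i, a i ∈ I (K i)) ∧ (∀ i, b i ∈ J (K i)) ∧
      c = ∑ i, trMap (g i) (h i) (a i * b i)}

/-- Prime ideals of the Burnside Tambara functor. -/
structure IsPrimeTambaraIdeal [Finite G] (P : ∀ H : Subgroup G, Ideal (A H)) : Prop
    extends IsTambaraIdeal P where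
  ne_top : ∃ H, P H ≠ ⊤
  mem_or_mem : ∀ I J : ∀ H : Subgroup G, Ideal (A H), IsTambaraIdeal I → IsTambaraIdeal J →
    (∀ H, mulSet I J H ⊆ P H) → (∀ H, I H ≤ P H) ∨ (∀ H, J H ≤ P H)

/-- `I` is subconjugate to `C` in `G`: some conjugate `I^g` is contained in `C`. -/
def Subconj (I C : Subgroup G) : Prop := ∃ g : G, conjSubgroup I g ≤ C

/-- The family `𝔭_{C,p}`: its value at `G/H` is the intersection of the kernels of `φ_{H,p}^I` over
the subgroups `I ≤ H` that are subconjugate to `C` in `G`. -/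
noncomputable def primeFamily (C : Subgroup G) (p : ℕ) (H : Subgroup G) : Ideal (A H) :=
  ⨅ (I : Subgroup G) (_ : I ≤ H) (_ : Subconj I C),
    RingHom.ker (BurnsideRing.markMod p (I.subgroupOf H))

end BurnsideTambara

/-! Everything is read off from marks. Restriction sends the mark at `I` to the mark at the image of
`I`. The mark of a transfer at `I` is a sum, over the cosets `γK` with `γ⁻¹Iγ ≤ K`, of marks at
`γ⁻¹Iγ`. The mark of a norm at `I` is a product, over the double cosets `KγI`, of marks at `γIγ⁻¹ ∩
K` (`BurnsideRing.mark_comap`, `mark_ind`, `mark_coind`). Since `C` is normal, being subconjugate to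
`C` means lying in `C`, and all subgroups in these formulas stay in `C` if `I` does. Hence the
family is closed under the Tambara operations.

For primality, let an ideal fail to lie in the family. Then one of its elements has a nonzero mark
modulo `p` at some `I ≤ C`. Restrict it to `I`, where this becomes the top mark, and take the norm
up to `C`. There is just one double coset in `I\C/C`, so the norm keeps the top mark, and the
correction term `N(0)` has top mark 0. This gives an element at `G/C` with nonzero top mark
(`exists_markMod_top_ne_zero`). For two such ideals, the product of these elements has nonzero top
mark because `ℤ/p` is a domain, so the product ideal is not contained in the family.

The delicate point is the norm of a virtual set, which is defined by polynomial extension. The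
product formula comes from counting fixed points of actual sets. Its right-hand side is polynomial
on the whole Burnside ring, and a polynomial map on the group is determined by its values on the
monoid (`newtonSub_eq_of_extends`), so the formula holds for all elements. -/

instance DoubleCoset.finite_quotient {Γ : Type*} [Group Γ] [Finite Γ] (s t : Set Γ) :
    Finite (DoubleCoset.Quotient s t) :=
  Quotient.finite _

/-! ### Degrees of products of additive maps -/

namespace PolyDegLT

variable {M A R : Type*} [AddCommMonoid M] [AddCommGroup A] [CommRing R]

theorem const (n : ℕ) (c : A) : PolyDegLT (n + 1) (fun _ : M => c) := by
  intro y
  have : fwdDiff y (fun _ : M => c) = 0 := by ext; simp [fwdDiff]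
  rw [this]
  exact zero n

theorem comp_addHom {B : Type*} [AddCommGroup B] (φ : A →+ B) {n : ℕ} {f : M → A}
    (hf : PolyDegLT n f) : PolyDegLT n (fun x => φ (f x)) := by
  induction n generalizing f with
  | zero =>
    have h : f = 0 := hf
    subst h
    funext x
    simp
  | succ n ih =>
    intro y
    have : fwdDiff y (fun x => φ (f x)) = fun x => φ (fwdDiff y f x) := by
      ext x; simp [fwdDiff]
    rw [this]
    exact ih (hf y)

/-- The product of an additive map with a polynomial map has degree at most one more. -/
theorem addHom_mul {n : ℕ} {f : M → R} (m : M →+ R) (hf : PolyDegLT n f) :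
    PolyDegLT (n + 1) (fun x => m x * f x) := by
  induction n generalizing f with
  | zero =>
    have h : f = 0 := hf
    subst h
    simpa using const (M := M) 0 (0 : R)
  | succ n ih =>
    intro y
    -- Discrete Leibniz rule. In the second term the factor `m y` is constant, so the degree is that
    -- of a shift of `f`.
    have h1 : fwdDiff y (fun x => m x * f x)
        = (fun x => m x * fwdDiff y f x) + fun x => AddMonoidHom.mulLeft (m y) (f (x + y)) := by
      ext x
      simp [fwdDiff]
      ring
    rw [h1]
    exact (ih (hf y)).add ((hf.shift y).comp_addHom _)

/-- Each additive factor raises the degree by at most one, starting from the constant 1. The slack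
`n` brings the bound into the form `n + k + 1` required by `newtonSub_eq_of_extends`, where `n`
comes from the norm and `k` is the number of factors. -/
theorem prod_addHom {ι : Type*} (s : Finset ι) (m : ι → M →+ R) (n : ℕ) :
    PolyDegLT (n + s.card + 1) (fun x => ∏ i ∈ s, m i x) := by
  classical
  induction s using Finset.induction_on with
  | empty => simpa using const n (1 : R)
  | insert i s hi ih =>
    simp only [Finset.prod_insert hi, Finset.card_insert_of_notMem hi]
    exact ih.addHom_mul (m i)

/-- The additional differences have order above the degree and vanish, so Newton's formulas
truncated at two different degree bounds can be compared. -/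
theorem newtonSub_add_right {n : ℕ} {f : M → A} (hf : PolyDegLT (n + 1) f) (k : ℕ) (x y : M) :
    newtonSub (n + k) f x y = newtonSub n f x y := by
  induction k with
  | zero => rfl
  | succ k ih =>
    have h0 : (fwdDiff y)^[n + k + 1] f = 0 := by
      rw [show n + k + 1 = k + (n + 1) by omega, Function.iterate_add_apply, hf.iter y]
      exact (zero k).iter y
    rw [← ih, ← add_assoc, newtonSub, Finset.sum_range_succ, h0]
    simp [newtonSub]

end PolyDegLT

/-! ### Uniqueness of polynomial extensions -/

section Newton

variable {M A B : Type*} [AddCommMonoid M] [AddCommGroup A] [AddCommGroup B]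

theorem map_newtonSub (φ : A →+ B) (n : ℕ) (f : M → A) (x y : M) :
    φ (newtonSub n f x y) = newtonSub n (fun z => φ (f z)) x y := by
  have h (k : ℕ) (f : M → A) (x : M) :
      φ ((fwdDiff y)^[k] f x) = (fwdDiff y)^[k] (fun z => φ (f z)) x := by
    induction k generalizing f with
    | zero => rfl
    | succ k ih =>
      rw [Function.iterate_succ_apply, Function.iterate_succ_apply, ih]
      refine congrArg (fun g => (fwdDiff y)^[k] g x) (funext fun z => ?_)
      simp [fwdDiff]
  simp [newtonSub, h]

theorem newtonSub_comp_addHom {N : Type*} [AddCommMonoid N] (e : N →+ M) (n : ℕ) (f : M → A)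
    (x y : N) : newtonSub n (fun z => f (e z)) x y = newtonSub n f (e x) (e y) := by
  have h (k : ℕ) (f : M → A) (x : N) :
      (fwdDiff y)^[k] (fun z => f (e z)) x = (fwdDiff (e y))^[k] f (e x) := by
    induction k generalizing f with
    | zero => rfl
    | succ k ih =>
      rw [Function.iterate_succ_apply, Function.iterate_succ_apply, ← ih]
      refine congrArg (fun g => (fwdDiff y)^[k] g x) (funext fun z => ?_)
      simp [fwdDiff]
  simp [newtonSub, h]

/-- If a polynomial map on a monoid extends along `e` to a polynomial map `F` on a group, then
Newton's formula computes the values of `F` at differences. -/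
theorem newtonSub_eq_of_extends {N : Type*} [AddCommGroup N] (e : M →+ N) {n k : ℕ} {f : M → A}
    {F : N → A} (hf : PolyDegLT (n + 1) f) (hF : PolyDegLT (n + k + 1) F)
    (h : ∀ x, f x = F (e x)) (x y : M) : newtonSub n f x y = F (e x - e y) := by
  -- Newton's formula for `F` is based at `(e x - e y) + e y = e x`, so it only involves values of
  -- `F` at the points `e (x + j • y)`, where `F` agrees with `f`.
  rw [← hf.newtonSub_add_right k, ← hF.newton_add _ (e y), sub_add_cancel,
    ← newtonSub_comp_addHom]
  congr 1
  exact funext h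

end Newton

/-! ### Fixed points of induced and coinduced sets -/

namespace FinGSet

variable {Γ Δ : Type u} [Group Γ] [Group Δ]

/-- The points of `X` fixed by the subgroup `I`. -/
abbrev fixed (X : FinGSet Γ) (I : Subgroup Γ) : Type u := {x : X.carrier // ∀ g ∈ I, g • x = x}

/-- A point of `Γ ×_Δ X` fixed by `I` lies over a coset `γ Δ` with `γ⁻¹ I γ ≤ Δ`, and is given by a
point of `X` that is fixed by `γ⁻¹ I γ`. -/
theorem card_fixed_ind [Finite Γ] (θ : Δ →* Γ) (hθ : Function.Injective θ) (X : FinGSet Δ)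
    (I : Subgroup Γ) :
    Nat.card ((ind θ X).fixed I)
      = Nat.card (Σ q : {q : Γ ⧸ θ.range // I.map (MulAut.conj q.out⁻¹).toMonoidHom ≤ θ.range},
        X.fixed ((I.map (MulAut.conj q.1.out⁻¹).toMonoidHom).comap θ)) := by
  symm
  let F : (Σ q : {q : Γ ⧸ θ.range // I.map (MulAut.conj q.out⁻¹).toMonoidHom ≤ θ.range},
      X.fixed ((I.map (MulAut.conj q.1.out⁻¹).toMonoidHom).comap θ)) → (ind θ X).fixed I :=
    fun s => ⟨Quotient.mk (indSetoid θ X) (s.1.1.out, s.2.1), fun i hi => by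
      obtain ⟨δ, hδ⟩ := s.1.2 ⟨i, hi, rfl⟩
      refine (smul_ind_mk θ X i _).trans (Quotient.sound ⟨δ, ?_, ?_⟩)
      · rw [hδ]
        simp [mul_assoc]
      · exact (s.2.2 δ ⟨i, hi, hδ.symm⟩).symm⟩
  refine Nat.card_congr (Equiv.ofBijective F ⟨?_, ?_⟩)
  · rintro ⟨⟨q, hq⟩, x⟩ ⟨⟨q', hq'⟩, x'⟩ h
    obtain ⟨δ, h₁, h₂⟩ := Quotient.exact (congrArg Subtype.val h)
    dsimp only at h₁ h₂
    -- Equal classes lie over the same coset, hence have the same chosen representative. Then `θ δ =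
    -- 1`, and injectivity of `θ` gives equal points of `X`.
    obtain rfl : q = q' := by
      rw [← q.out_eq', ← q'.out_eq']
      exact (QuotientGroup.eq.2 (MonoidHom.mem_range.2 ⟨δ, by rw [h₁]; group⟩)).symm
    obtain rfl : δ = 1 := hθ (by simpa using h₁)
    have : x = x' := Subtype.ext (by simpa using h₂.symm)
    rw [this]
  · rintro ⟨z, hz⟩
    obtain ⟨⟨γ, x⟩, rfl⟩ := Quotient.exists_rep z
    set q : Γ ⧸ θ.range := (γ : Γ ⧸ θ.range) with hq
    obtain ⟨δ, hδ⟩ : q.out⁻¹ * γ ∈ θ.range := QuotientGroup.eq.1 q.out_eq'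
    have hγ : γ = q.out * θ δ := by rw [hδ]; group
    have hrep : Quotient.mk (indSetoid θ X) (γ, x)
        = Quotient.mk (indSetoid θ X) (q.out, δ • x) := Quotient.sound ⟨δ, hγ, rfl⟩
    -- After moving to the chosen representative, `i` fixes the class exactly when `i * q.out =
    -- q.out * θ ε` for some `ε` that fixes `δ • x`.
    have key (i : Γ) (hi : i ∈ I) : ∃ ε : Δ, θ ε = q.out⁻¹ * i * q.out ∧ ε • δ • x = δ • x := by
      have h := hz i hi
      rw [hrep] at h
      obtain ⟨ε, h₁, h₂⟩ := Quotient.exact ((smul_ind_mk θ X i _).symm.trans h)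
      dsimp only at h₁ h₂
      exact ⟨ε, by rw [mul_assoc, h₁]; group, h₂.symm⟩
    refine ⟨⟨⟨q, ?_⟩, ⟨δ • x, ?_⟩⟩, Subtype.ext hrep.symm⟩
    · rintro _ ⟨i, hi, rfl⟩
      obtain ⟨ε, h, -⟩ := key i hi
      exact ⟨ε, by simpa using h⟩
    · rintro ε' ⟨i, hi, hε'⟩
      obtain ⟨ε, h, h'⟩ := key i hi
      obtain rfl : ε' = ε := hθ (by rw [h, ← hε']; simp)
      exact h'

/-- An `I`-fixed point of `Map_Δ(Γ, X)` is given by its values at representatives `γ` of the double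
cosets, and the value at `γ` is any point fixed by `γ I γ⁻¹ ∩ Δ`. -/
theorem card_fixed_coind [Finite Γ] (θ : Δ →* Γ) (X : FinGSet Δ) (I : Subgroup Γ) :
    Nat.card ((coind θ X).fixed I)
      = Nat.card (∀ q : DoubleCoset.Quotient (θ.range : Set Γ) (I : Set Γ),
        X.fixed ((I.map (MulAut.conj q.out).toMonoidHom).comap θ)) := by
  have hrep (γ : Γ) : ∃ (δ : Δ) (i : I),
      θ δ * (DoubleCoset.mk θ.range I γ).out * (i : Γ) = γ := by
    obtain ⟨h, i, ⟨δ, rfl⟩, hi, e⟩ := DoubleCoset.mk_out_eq_mul θ.range I γ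
    refine ⟨δ⁻¹, ⟨i⁻¹, inv_mem hi⟩, ?_⟩
    rw [e]
    simp [mul_assoc]
  choose d c hdc using hrep
  let F (f : (coind θ X).fixed I) (q : DoubleCoset.Quotient (θ.range : Set Γ) (I : Set Γ)) :
      X.fixed ((I.map (MulAut.conj q.out).toMonoidHom).comap θ) :=
    ⟨f.1.1 q.out, by
      rintro δ ⟨i, hi, h⟩
      have h' : q.out * i = θ δ * q.out := by
        rw [← h]; simp
      rw [← f.1.2, ← h']
      exact congrFun (congrArg Subtype.val (f.2 i hi)) q.out⟩
  have hfix (f : (coind θ X).fixed I) (γ : Γ) (i : I) : f.1.1 (γ * i) = f.1.1 γ :=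
    congrFun (congrArg Subtype.val (f.2 i i.2)) γ
  refine Nat.card_congr (Equiv.ofBijective F ⟨fun f f' h => ?_, fun x => ?_⟩)
  · refine Subtype.ext (Subtype.ext (funext fun γ => ?_))
    have h1 : f.1.1 (DoubleCoset.mk θ.range I γ).out = f'.1.1 (DoubleCoset.mk θ.range I γ).out :=
      congrArg Subtype.val (congrFun h (DoubleCoset.mk θ.range I γ))
    rw [← hdc γ, hfix, hfix, f.1.2, f'.1.2, h1]
  -- The inverse sends `x` to `γ ↦ d γ • x (mk γ)`. Its value does not depend on how `γ` is
  -- decomposed as `θ δ * q.out * i`. Equivariance, fixedness under `I` and the prescribed value at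
  -- `q.out` all follow by choosing suitable decompositions.
  · have key (γ : Γ) (q : DoubleCoset.Quotient (θ.range : Set Γ) (I : Set Γ)) (δ : Δ) (i : I)
        (h : θ δ * q.out * i = γ) : d γ • (x (DoubleCoset.mk θ.range I γ)).1 = δ • (x q).1 := by
      obtain rfl : DoubleCoset.mk θ.range I γ = q := by
        rw [← DoubleCoset.out_eq' _ _ q]
        refine ((DoubleCoset.eq _ _ _ _).2 ⟨θ δ, MonoidHom.mem_range.2 ⟨δ, rfl⟩, i, i.2, h.symm⟩).symm
      have h2 := hdc γ
      set q := DoubleCoset.mk θ.range I γ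
      have h3 : (δ⁻¹ * d γ) • (x q).1 = (x q).1 := by
        -- Comparing `θ δ * q.out * i` with `θ (d γ) * q.out * c γ` shows that `θ (δ⁻¹ * d γ)` is
        -- the conjugate of `i * (c γ)⁻¹` by `q.out`, so this element of `Δ` fixes `x q`.
        refine (x q).2 _ ⟨i * (c γ : Γ)⁻¹, mul_mem i.2 (inv_mem (c γ).2), ?_⟩
        have h4 : (i : Γ) = q.out⁻¹ * (θ δ)⁻¹ * γ := by rw [← h]; group
        have h5 : (c γ : Γ) = q.out⁻¹ * (θ (d γ))⁻¹ * γ := by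
          rw [mul_assoc, eq_inv_mul_iff_mul_eq, eq_inv_mul_iff_mul_eq, ← mul_assoc]
          exact h2
        simp only [MulEquiv.coe_toMonoidHom, MulAut.conj_apply, map_mul, map_inv, h4, h5]
        group
      rw [mul_smul, inv_smul_eq_iff] at h3
      exact h3
    refine ⟨⟨⟨fun γ => d γ • (x (DoubleCoset.mk θ.range I γ)).1, fun δ γ => ?_⟩, fun j hj => ?_⟩,
      funext fun q => Subtype.ext ?_⟩
    · rw [← mul_smul]
      exact key _ _ _ (c γ) (by rw [map_mul, mul_assoc, mul_assoc, ← mul_assoc _ _ (c γ : Γ), hdc])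
    · refine Subtype.ext (funext fun γ => ?_)
      exact key _ _ _ (c γ * ⟨j, hj⟩) (by rw [Subgroup.coe_mul, ← mul_assoc, hdc])
    · exact (key _ q 1 1 (by simp)).trans (one_smul _ _)

end FinGSet

/-! ### Marks of restrictions, transfers and norms -/

namespace BurnsideRing

variable {Γ Δ : Type u} [Group Γ] [Group Δ]

theorem addHom_ext {M : Type*} [AddCommGroup M] {f g : BurnsideRing Γ →+ M}
    (h : ∀ X, f (ofSet X) = g (ofSet X)) : f = g := by
  have h' (x : BurnsideSemiring Γ) : f (GrothendieckRing.of x) = g (GrothendieckRing.of x) := by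
    induction x using BurnsideSemiring.ind_mk with | h X => exact h X
  ext a
  obtain ⟨x, y, rfl⟩ := GrothendieckRing.exists_rep a
  rw [map_sub, map_sub]
  exact congrArg₂ _ (h' x) (h' y)

theorem mark_ofSet (I : Subgroup Γ) (X : FinGSet Γ) :
    mark I (ofSet X) = Nat.card (X.fixed I) :=
  GrothendieckRing.lift_of _ _

theorem comap_ofSet (θ : Δ →* Γ) (X : FinGSet Γ) :
    comap θ (ofSet X) = ofSet (FinGSet.comap θ X) :=
  GrothendieckRing.lift_of _ _

theorem ind_ofSet [Finite Γ] (θ : Δ →* Γ) (X : FinGSet Δ) :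
    ind θ (ofSet X) = ofSet (FinGSet.ind θ X) :=
  GrothendieckRing.liftAdd_of _ _

/-- `I` acts on the pulled-back set through its image under `θ`, so the fixed points are the same.
-/
theorem mark_comap (θ : Δ →* Γ) (I : Subgroup Δ) (a : BurnsideRing Γ) :
    mark I (comap θ a) = mark (I.map θ) a := by
  refine DFunLike.congr_fun (f := ((mark I).comp (comap θ)).toAddMonoidHom)
    (g := (mark (I.map θ)).toAddMonoidHom) (addHom_ext fun X => ?_) a
  refine (congrArg (mark I) (comap_ofSet θ X)).trans ((mark_ofSet _ _).trans
    (Eq.trans ?_ (mark_ofSet _ _).symm))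
  refine congrArg _ (Nat.card_congr (Equiv.subtypeEquivRight fun x => ?_))
  exact ⟨by rintro h _ ⟨δ, hδ, rfl⟩; exact h δ hδ, fun h δ hδ => h _ ⟨δ, hδ, rfl⟩⟩

/-- The marks of an induced element. -/
theorem mark_ind [Finite Γ] (θ : Δ →* Γ) (hθ : Function.Injective θ) (I : Subgroup Γ)
    (a : BurnsideRing Δ) :
    mark I (ind θ a)
      = ∑ᶠ q : {q : Γ ⧸ θ.range // I.map (MulAut.conj q.out⁻¹).toMonoidHom ≤ θ.range},
        mark ((I.map (MulAut.conj q.1.out⁻¹).toMonoidHom).comap θ) a := by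
  have := Fintype.ofFinite
    {q : Γ ⧸ θ.range // I.map (MulAut.conj q.out⁻¹).toMonoidHom ≤ θ.range}
  rw [finsum_eq_sum_of_fintype]
  have h : (mark I).toAddMonoidHom.comp (ind θ)
      = ∑ q : {q : Γ ⧸ θ.range // I.map (MulAut.conj q.out⁻¹).toMonoidHom ≤ θ.range},
        (mark ((I.map (MulAut.conj q.1.out⁻¹).toMonoidHom).comap θ)).toAddMonoidHom := by
    refine addHom_ext fun X => ?_
    simp only [AddMonoidHom.comp_apply, AddMonoidHom.finsetSum_apply, ind_ofSet,
      RingHom.toAddMonoidHom_eq_coe, AddMonoidHom.coe_coe, mark_ofSet, FinGSet.card_fixed_ind θ hθ,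
      Nat.card_sigma]
    push_cast
    rfl
  simpa using DFunLike.congr_fun h a

/-- The marks of a coinduced element. -/
theorem mark_coind [Finite Γ] (θ : Δ →* Γ) (I : Subgroup Γ) (a : BurnsideRing Δ) :
    mark I (coind θ a)
      = ∏ᶠ q : DoubleCoset.Quotient (θ.range : Set Γ) (I : Set Γ),
        mark ((I.map (MulAut.conj q.out).toMonoidHom).comap θ) a := by
  have := Fintype.ofFinite (DoubleCoset.Quotient (θ.range : Set Γ) (I : Set Γ))
  rw [finprod_eq_prod_of_fintype]
  obtain ⟨x, y, h⟩ := GrothendieckRing.exists_rep a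
  have h' : a = GrothendieckRing.of x - GrothendieckRing.of y := h
  rw [h', coind_of_sub_of, ← AddMonoidHom.coe_coe (mark I), map_newtonSub]
  have hdeg := (PolyDegLT.prod_addHom Finset.univ
    (fun q : DoubleCoset.Quotient (θ.range : Set Γ) (I : Set Γ) =>
      (mark ((I.map (MulAut.conj q.out).toMonoidHom).comap θ)).toAddMonoidHom) θ.range.index)
  -- The left side is Newton's formula for `X ↦ |Map_Δ(Γ, X)^I|`, of degree at most the index. The
  -- product of marks is polynomial on the whole Burnside ring, so it remains to compare both on
  -- actual sets.
  refine newtonSub_eq_of_extends (GrothendieckRing.of (S := BurnsideSemiring Δ)).toAddMonoidHom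
    ((BurnsideSemiring.coind_polyDegLT θ).comp_addHom _) hdeg (fun z => ?_) x y
  induction z using BurnsideSemiring.ind_mk with | h X =>
  refine (mark_ofSet I (FinGSet.coind θ X)).trans ?_
  rw [FinGSet.card_fixed_coind, Nat.card_pi, Nat.cast_prod]
  exact Finset.prod_congr rfl fun q _ => (mark_ofSet _ X).symm

end BurnsideRing
-- Membership in the family via subgroups of `C`
namespace BurnsideTambara

variable {G : Type u} [Group G]

/-- Normality of `C` turns subconjugacy to `C` into containment in `C`, and subgroups of `G` inside
`H` become subgroups of the group `H`, the form in which the mark formulas apply. -/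
theorem mem_primeFamily_iff (C : Subgroup G) [C.Normal] (p : ℕ) {H : Subgroup G} {a : A H} :
    a ∈ primeFamily C p H
      ↔ ∀ I : Subgroup H, I ≤ C.subgroupOf H → BurnsideRing.markMod p I a = 0 := by
  simp only [primeFamily, Ideal.mem_iInf, RingHom.mem_ker]
  constructor
  · intro h I hI
    have hI' : (I.map H.subtype).subgroupOf H = I :=
      Subgroup.comap_map_eq_self_of_injective H.subtype_injective I
    have h' := h (I.map H.subtype) (Subgroup.map_subtype_le I) ⟨1, fun k hk => ?_⟩
    · rwa [hI'] at h'
    · obtain ⟨i, hi, hk'⟩ := mem_conjSubgroup.1 hk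
      have : (i : G) = k := by simpa using hk'
      exact this ▸ hI hi
  · rintro h I - ⟨g, hg⟩
    refine h _ fun i hi => ?_
    have hi' : g⁻¹ * i * g ∈ C := hg (mem_conjSubgroup.2 (by
      simpa [mul_assoc] using Subgroup.mem_subgroupOf.1 hi))
    have h1 := Subgroup.Normal.conj_mem ‹C.Normal› _ hi' g
    refine Subgroup.mem_subgroupOf.2 ?_
    simpa [mul_assoc] using h1

theorem markMod_apply {Γ : Type u} [Group Γ] (p : ℕ) (I : Subgroup Γ) (a : BurnsideRing Γ) :
    BurnsideRing.markMod p I a = (BurnsideRing.mark I a : ZMod p) := rfl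

theorem markMod_comap {Γ Δ : Type u} [Group Γ] [Group Δ] (p : ℕ) (θ : Δ →* Γ) (I : Subgroup Δ)
    (a : BurnsideRing Γ) :
    BurnsideRing.markMod p I (BurnsideRing.comap θ a) = BurnsideRing.markMod p (I.map θ) a := by
  rw [markMod_apply, markMod_apply, BurnsideRing.mark_comap]

theorem markMod_conj (p : ℕ) (H : Subgroup G) (g : G) (I : Subgroup (conjSubgroup H g)) (a : A H) :
    BurnsideRing.markMod p I (conj H g a)
      = BurnsideRing.markMod p (I.map ((MulAut.conj g).toMonoidHom.subgroupComap H)) a :=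
  markMod_comap p _ I a

/-- If `I` lies in the normal subgroup `C`, then so do the subgroups `g I g⁻¹ ∩ K`. -/
theorem comap_map_conj_le (C : Subgroup G) [C.Normal] {K H : Subgroup G} (h : K ≤ H)
    {I : Subgroup H} (hI : I ≤ C.subgroupOf H) (g : H) :
    (I.map (MulAut.conj g).toMonoidHom).comap (Subgroup.inclusion h) ≤ C.subgroupOf K := by
  rintro k ⟨i, hi, e⟩
  have h1 := Subgroup.Normal.conj_mem ‹C.Normal› _ (Subgroup.mem_subgroupOf.1 (hI hi)) (g : G)
  have h2 : (g : G) * i * (g : G)⁻¹ = k := congrArg Subtype.val e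
  rw [h2] at h1
  exact Subgroup.mem_subgroupOf.2 h1

/-! ### Tambara operations on marks modulo `p` -/

section Finite

variable [Finite G]

theorem tr_mem_primeFamily (C : Subgroup G) [C.Normal] (p : ℕ) {K H : Subgroup G} (h : K ≤ H)
    {a : A K} (ha : a ∈ primeFamily C p K) : tr h a ∈ primeFamily C p H := by
  rw [mem_primeFamily_iff] at ha ⊢
  intro I hI
  have := Fintype.ofFinite {q : H ⧸ (Subgroup.inclusion h).range //
    I.map (MulAut.conj q.out⁻¹).toMonoidHom ≤ (Subgroup.inclusion h).range}
  rw [markMod_apply, tr, BurnsideRing.mark_ind _ (Subgroup.inclusion_injective h),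
    finsum_eq_sum_of_fintype, Int.cast_sum]
  exact Finset.sum_eq_zero fun q _ => ha _ (comap_map_conj_le C h hI _)

theorem markMod_norm (p : ℕ) {K H : Subgroup G} (h : K ≤ H) (I : Subgroup H) (a : A K) :
    BurnsideRing.markMod p I (norm h a)
      = ∏ᶠ q : DoubleCoset.Quotient ((Subgroup.inclusion h).range : Set H) (I : Set H),
        BurnsideRing.markMod p
          ((I.map (MulAut.conj q.out).toMonoidHom).comap (Subgroup.inclusion h)) a := by
  have := Fintype.ofFinite
    (DoubleCoset.Quotient ((Subgroup.inclusion h).range : Set H) (I : Set H))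
  rw [markMod_apply, norm, BurnsideRing.mark_coind, finprod_eq_prod_of_fintype,
    finprod_eq_prod_of_fintype, Int.cast_prod]
  rfl

/-- There is always a double coset, that of 1, so the product is not empty and one vanishing factor
kills it. In particular `N(0)` has zero marks. -/
theorem markMod_norm_eq_zero (p : ℕ) {K H : Subgroup G} (h : K ≤ H) (I : Subgroup H) (a : A K)
    (ha : ∀ g : H, BurnsideRing.markMod p
      ((I.map (MulAut.conj g).toMonoidHom).comap (Subgroup.inclusion h)) a = 0) :
    BurnsideRing.markMod p I (norm h a) = 0 := by
  have := Fintype.ofFinite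
    (DoubleCoset.Quotient ((Subgroup.inclusion h).range : Set H) (I : Set H))
  rw [markMod_norm, finprod_eq_prod_of_fintype]
  exact Finset.prod_eq_zero (Finset.mem_univ (DoubleCoset.mk _ _ 1)) (ha _)

/-- Transfer along an equality does not change the top mark. -/
theorem markMod_top_tr (p : ℕ) {K H : Subgroup G} (h : K ≤ H) (h' : H ≤ K) (a : A K) :
    BurnsideRing.markMod p ⊤ (tr h a) = BurnsideRing.markMod p ⊤ a := by
  have hr : (Subgroup.inclusion h).range = ⊤ := by
    rw [Subgroup.inclusion_range, Subgroup.subgroupOf_eq_top]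
    exact h'
  have hsub : Subsingleton (H ⧸ (Subgroup.inclusion h).range) := by
    rw [hr]
    exact QuotientGroup.subsingleton_quotient_top
  rw [markMod_apply, tr, BurnsideRing.mark_ind _ (Subgroup.inclusion_injective h),
    -- The only coset contributes the conjugate of the full group pulled back to `K`, which is all
    -- of `K`.
    finsum_eq_single _ ⟨(1 : H), by rw [hr]; exact le_top⟩
      fun q hq => absurd (Subsingleton.elim _ _) hq,
    Subgroup.map_top_of_surjective _ (MulEquiv.surjective _), Subgroup.comap_top, markMod_apply]

/-- The top mark of a norm is the top mark. -/
theorem markMod_top_norm (p : ℕ) {K H : Subgroup G} (h : K ≤ H) (a : A K) :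
    BurnsideRing.markMod p ⊤ (norm h a) = BurnsideRing.markMod p ⊤ a := by
  have hsub : Subsingleton
      (DoubleCoset.Quotient ((Subgroup.inclusion h).range : Set H) ((⊤ : Subgroup H) : Set H)) := by
    refine ⟨fun x y => ?_⟩
    rw [← DoubleCoset.out_eq' _ _ x, ← DoubleCoset.out_eq' _ _ y, DoubleCoset.eq]
    -- The right factor ranges over all of `H`, so it can carry any representative to any other.
    exact ⟨1, one_mem _, x.out⁻¹ * y.out, trivial, by simp⟩
  rw [markMod_norm, finprod_eq_single _ (DoubleCoset.mk _ _ 1)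
    fun x hx => absurd (Subsingleton.elim _ _) hx,
    Subgroup.map_top_of_surjective _ (MulEquiv.surjective _), Subgroup.comap_top]

theorem norm_mem_primeFamily (C : Subgroup G) [C.Normal] (p : ℕ) {K H : Subgroup G} (h : K ≤ H)
    {a : A K} (ha : a ∈ primeFamily C p K) : norm h a ∈ primeFamily C p H := by
  rw [mem_primeFamily_iff] at ha ⊢
  exact fun I hI => markMod_norm_eq_zero p h I a fun g => ha _ (comap_map_conj_le C h hI g)

theorem isTambaraIdeal_primeFamily (C : Subgroup G) [C.Normal] (p : ℕ) :
    IsTambaraIdeal (primeFamily C p) where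
  res_mem h a ha := by
    rw [mem_primeFamily_iff] at ha ⊢
    intro I hI
    rw [res, markMod_comap]
    refine ha _ ?_
    rintro _ ⟨k, hk, rfl⟩
    exact hI hk
  tr_mem h a ha := tr_mem_primeFamily C p h ha
  -- Both norms lie in the family, so their difference is an admissible correction.
  norm_mem h a ha := ⟨norm h a - norm h 0, sub_mem (norm_mem_primeFamily C p h ha)
    (norm_mem_primeFamily C p h (zero_mem _)), (sub_add_cancel _ _).symm⟩
  conj_mem H g a ha := by
    rw [mem_primeFamily_iff] at ha ⊢
    intro I hI
    rw [markMod_conj]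
    refine ha _ ?_
    rintro _ ⟨k, hk, rfl⟩
    exact Subgroup.Normal.conj_mem ‹C.Normal› _ (hI hk) g

/-- An ideal that is not contained in `𝔭_{C,p}` has an element at `G/C` with nonzero top mark. -/
theorem exists_markMod_top_ne_zero (C : Subgroup G) [C.Normal] (p : ℕ)
    {J : ∀ H : Subgroup G, Ideal (A H)} (hJ : IsTambaraIdeal J)
    (h : ¬ ∀ H, J H ≤ primeFamily C p H) : ∃ a ∈ J C, BurnsideRing.markMod p ⊤ a ≠ 0 := by
  simp only [SetLike.le_def, mem_primeFamily_iff] at h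
  push Not at h
  obtain ⟨H, a, ha, I, hI, hne⟩ := h
  have hIC : I.map H.subtype ≤ C := Subgroup.map_le_iff_le_comap.2 hI
  -- Restriction to `I`, seen as a subgroup of `G`, followed by the norm up to `C`; the result lies
  -- in `J` up to `N(0)`.
  obtain ⟨b, hb, hn⟩ := hJ.norm_mem hIC _ (hJ.res_mem (Subgroup.map_subtype_le I) a ha)
  refine ⟨b, hb, ?_⟩
  have h0 : BurnsideRing.markMod p ⊤ (norm hIC 0) = 0 := by rw [markMod_top_norm, map_zero]
  have htop : (⊤ : Subgroup (I.map H.subtype)).map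
      (Subgroup.inclusion (Subgroup.map_subtype_le I)) = I := by
    rw [← MonoidHom.range_eq_map, Subgroup.inclusion_range]
    exact Subgroup.comap_map_eq_self_of_injective H.subtype_injective I
  rwa [eq_sub_of_add_eq hn.symm, map_sub, h0, sub_zero, markMod_top_norm, res, markMod_comap, htop]

end Finite

end BurnsideTambara

/-! ### Primality -/

open BurnsideTambara in
theorem theorem3p7 {G : Type*} [Group G] [Finite G] (C : Subgroup G) [C.Normal]
    (p : ℕ) (hp : p.Prime ∨ p = 0) :
    BurnsideTambara.IsPrimeTambaraIdeal (BurnsideTambara.primeFamily C p) := by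
  have hdom : IsDomain (ZMod p) := by
    obtain hp | rfl := hp
    · have := Fact.mk hp
      infer_instance
    · exact inferInstanceAs (IsDomain ℤ)
  refine ⟨isTambaraIdeal_primeFamily C p, ⟨⊥, fun h => ?_⟩, fun I J hI hJ hIJ => ?_⟩
  -- Properness is visible at the trivial subgroup, where the unit has mark 1.
  · have h1 : (1 : A (⊥ : Subgroup G)) ∈ primeFamily C p ⊥ := h ▸ Submodule.mem_top
    have h2 := (mem_primeFamily_iff C p).1 h1 ⊥ bot_le
    rw [map_one] at h2
    exact one_ne_zero h2
  · by_contra hcon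
    rw [not_or] at hcon
    obtain ⟨a, ha, ha'⟩ := exists_markMod_top_ne_zero C p hI hcon.1
    obtain ⟨b, hb, hb'⟩ := exists_markMod_top_ne_zero C p hJ hcon.2
    have hC : conjSubgroup C 1 ≤ C := fun k hk => by simpa [mem_conjSubgroup] using hk
    have hC' : C ≤ conjSubgroup C 1 := fun k hk => by simpa [mem_conjSubgroup] using hk
    -- A single orbit `S = G/C` and the identity map of `G/C`. The map `f_+` is then conjugation by
    -- 1 followed by transfer along an equality of subgroups, and `hmark` shows that it preserves
    -- the top mark.
    have hmem := hIJ C ⟨1, fun _ => C, fun _ => 1, fun _ => hC, fun _ => a, fun _ => b,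
      fun _ => ha, fun _ => hb, rfl⟩
    have hmark (x : A C) : BurnsideRing.markMod p ⊤ (trMap 1 hC x)
        = BurnsideRing.markMod p ⊤ x := by
      refine (markMod_top_tr p hC hC' _).trans ((markMod_conj p C 1 ⊤ x).trans ?_)
      refine congrArg (fun I => BurnsideRing.markMod p I x)
        (Subgroup.map_top_of_surjective _ fun c => ⟨⟨c, hC' c.2⟩, Subtype.ext ?_⟩)
      show (1 : G) * c * 1⁻¹ = c
      simp
    have h3 := (mem_primeFamily_iff C p).1 hmem ⊤ fun x _ => x.2
    rw [Finset.sum_const, Finset.card_univ, Fintype.card_fin, one_smul, hmark, map_mul] at h3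
    exact mul_ne_zero ha' hb' h3
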